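/- Let $M$ be a W*-algebra (a C*-algebra with a Banach space predual). A projection $p\in M$ is infinite if there are $u\in M$ and a projection $q\le p$, $q\neq p$, with $u^*u=p$ and $uu^*=q$; $M$ is properly infinite if every nonzero central projection of $M$ is infinite. For $N\in\{2,3,4,\dots\}\cup\{\infty\}$ let $I$ be an index set with $N$ elements (countably infinite if $N=\infty$). A Cuntz inverse semigroup $S_N$ in $M$ is a set of the form $$S_N=\{0\}\cup\{s_{i_1}\cdots s_{i_k}s_{j_1}^*\cdots s_{j_l}^* : k,l\ge 0,\ i_1,\dots,i_k,j_1,\dots,j_l\in I\},$$ where $e\in M$ is a projection (the unit of $S_N$, to which the empty product is equal) and the elements $s_i\in eMe$ $(i\in I)$ satisfy $s_i^*s_i=e$, the projections $s_is_i^*$ are mutually orthogonal, and $\sum_{i\in I}s_is_i^*=e$ (the sum being the least upper bound of the finite partial sums). Then $M$ is properly infinite if and only if, for some $N\in\{2,3,4,\dots\}\cup\{\infty\}$, it contains a Cuntz inverse semigroup $S_N$ such that $\mathbf 1\in S_N$. Moreover, if $M$ is properly infinite, then it contains such a semigroup $S_N$ with $\mathbf 1\in S_N$ for every $N\in\{2,3,4,\dots\}\cup\{\infty\}$.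 -/

import Mathlib

namespace CuntzW

/-- Murray–von Neumann equivalence `p ∼ q`: some partial isometry `u` has
initial projection `u⋆ u = p` and final projection `u u⋆ = q`. -/
def ProjEquiv {M : Type*} [CStarAlgebra M] (p q : M) : Prop :=
  ∃ u : M, star u * u = p ∧ u * star u = q

/-- A projection `p` is infinite if it is equivalent to a proper subprojection of itself. -/
def IsInfiniteProj {M : Type*} [CStarAlgebra M] [PartialOrder M] (p : M) : Prop :=
  IsStarProjection p ∧ ∃ q : M, IsStarProjection q ∧ q ≤ p ∧ q ≠ p ∧ ProjEquiv p q

/-- The algebra `M` is properly infinite if each of its nonzero central projections is infinite. -/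
def IsProperlyInfinite (M : Type*) [CStarAlgebra M] [PartialOrder M] : Prop :=
  ∀ z : M, IsStarProjection z → z ∈ Set.center M → z ≠ 0 → IsInfiniteProj z

/-- The index set `I` of cardinality `N`: the set `{0, …, N - 1}` if `N` is finite,
and all of `ℕ` if `N = ∞`. -/
abbrev Index (N : ℕ∞) : Type := {n : ℕ // (n : ℕ∞) < N}

/-- A family `s` of isometries relative to the unit `e` (a projection of `M`, possibly different
from `1`), that is `sᵢ⋆ sᵢ = e` and `sᵢ ∈ e M e`, such that the range projections `sᵢ sᵢ⋆` are
mutually orthogonal and have sum `e`. As usual in a W⋆-algebra, the sum of a family of positive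
elements is the least upper bound of its finite partial sums. -/
structure IsCuntzFamily {M : Type*} [CStarAlgebra M] [PartialOrder M] {I : Type*}
    (e : M) (s : I → M) : Prop where
  proj : IsStarProjection e
  star_mul_self : ∀ i, star (s i) * s i = e
  unit_mul : ∀ i, e * s i = s i
  mul_unit : ∀ i, s i * e = s i
  orthogonal : ∀ i j, i ≠ j → star (s i) * s j = 0
  sum_eq : IsLUB (Set.range fun F : Finset I => ∑ i ∈ F, s i * star (s i)) e

/-- The product `s_α = s_{i₁} ⋯ s_{iₖ}` for a word `α = (i₁, …, iₖ)`; the empty product is the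
unit `e`. -/
def word {M : Type*} [CStarAlgebra M] {I : Type*} (e : M) (s : I → M) : List I → M
  | [] => e
  | i :: α => s i * word e s α

section

variable {M : Type*} [CStarAlgebra M] [PartialOrder M] {I : Type*} {e : M} {s : I → M}

theorem IsCuntzFamily.unit_mul_word (h : IsCuntzFamily e s) (α : List I) :
    e * word e s α = word e s α := by
  cases α with
  | nil => exact h.proj.isIdempotentElem
  | cons i α => simp only [word, ← mul_assoc, h.unit_mul]

theorem IsCuntzFamily.word_mul_unit (h : IsCuntzFamily e s) (α : List I) :
    word e s α * e = word e s α := by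
  induction α with
  | nil => exact h.proj.isIdempotentElem
  | cons i α ih => simp only [word, mul_assoc, ih]

theorem IsCuntzFamily.word_append (h : IsCuntzFamily e s) (α β : List I) :
    word e s (α ++ β) = word e s α * word e s β := by
  induction α with
  | nil => exact (h.unit_mul_word β).symm
  | cons i α ih => simp only [word, List.cons_append, mul_assoc, ih]

theorem IsCuntzFamily.star_word_mul_word (h : IsCuntzFamily e s) (β γ : List I) :
    star (word e s β) * word e s γ = 0 ∨
      (∃ δ, star (word e s β) * word e s γ = word e s δ) ∨
        ∃ δ, star (word e s β) * word e s γ = star (word e s δ) := by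
  induction β generalizing γ with
  | nil =>
    refine Or.inr (Or.inl ⟨γ, ?_⟩)
    rw [word, h.proj.isSelfAdjoint.star_eq, h.unit_mul_word]
  | cons i β ih =>
    cases γ with
    | nil =>
      refine Or.inr (Or.inr ⟨i :: β, ?_⟩)
      have := congrArg star (h.unit_mul_word (i :: β))
      rwa [star_mul, h.proj.isSelfAdjoint.star_eq] at this
    | cons j γ =>
      by_cases hij : i = j
      · subst hij
        have : star (word e s (i :: β)) * word e s (i :: γ)
            = star (word e s β) * word e s γ := by
          rw [word, word, star_mul, mul_assoc, ← mul_assoc (star (s i)), h.star_mul_self,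
            h.unit_mul_word]
        rw [this]
        exact ih γ
      · left
        rw [word, word, star_mul, mul_assoc, ← mul_assoc (star (s i)), h.orthogonal i j hij,
          zero_mul, mul_zero]

/-- The Cuntz inverse semigroup of a Cuntz family: all elements
`s_{i₁} ⋯ s_{iₖ} s_{j₁}⋆ ⋯ s_{jₗ}⋆ = s_α s_β⋆` with `k, l ≥ 0`, together with the zero element
(which is `sᵢ⋆ sⱼ` for `i ≠ j`). The inverse of an element is its adjoint. -/
def cuntzInverseSemigroup (h : IsCuntzFamily e s) : Subsemigroup M where
  carrier := {x | x = 0 ∨ ∃ α β : List I, x = word e s α * star (word e s β)}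
  mul_mem' := by
    rintro x y (rfl | ⟨α, β, rfl⟩) hy
    · exact Or.inl (zero_mul y)
    rcases hy with rfl | ⟨γ, δ, rfl⟩
    · exact Or.inl (mul_zero _)
    have key : word e s α * star (word e s β) * (word e s γ * star (word e s δ))
        = word e s α * (star (word e s β) * word e s γ) * star (word e s δ) := by
      simp only [mul_assoc]
    rw [key]
    rcases h.star_word_mul_word β γ with h0 | ⟨ε, hε⟩ | ⟨ε, hε⟩
    · left
      rw [h0, mul_zero, zero_mul]
    · right
      exact ⟨α ++ ε, δ, by rw [hε, h.word_append]⟩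
    · right
      exact ⟨α, δ ++ ε, by rw [hε, h.word_append, star_mul, mul_assoc]⟩

theorem star_mem_cuntzInverseSemigroup (h : IsCuntzFamily e s) {x : M}
    (hx : x ∈ cuntzInverseSemigroup h) : star x ∈ cuntzInverseSemigroup h := by
  rcases hx with rfl | ⟨α, β, rfl⟩
  · exact Or.inl (star_zero M)
  · exact Or.inr ⟨β, α, by rw [star_mul, star_star]⟩

end

/-- `S` is a Cuntz inverse semigroup `S_N` in `M`. -/
def IsCuntzInverseSemigroup {M : Type*} [CStarAlgebra M] [PartialOrder M] (N : ℕ∞)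
    (S : Subsemigroup M) : Prop :=
  ∃ (e : M) (s : Index N → M) (h : IsCuntzFamily e s), S = cuntzInverseSemigroup h

end CuntzW

/-!
If `1 ∈ S_N`, then the unit `e` of `S_N` is `1`, and every nonzero central projection `z` is
infinite since `z sᵢ` is a partial isometry from `z` to the proper subprojection `z sᵢ sᵢ⋆`
(`isProperlyInfinite_of_isCuntzFamily`).

For the converse it suffices to find two isometries `s₁`, `s₂` with orthogonal ranges
(`HasOrthogonalCopies 1`). The isometries `s₁ⁿ s₂` then have orthogonal ranges as well, and a
Schröder–Bernstein argument (`exists_isometry_onto`) enlarges the range of one of them so that the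
ranges add up to `1`; this works for any number `N ≥ 1` of isometries (`exists_isCuntzFamily`).

The two isometries come from the Murray–von Neumann comparison theory. An infinite central
projection `y` contains infinitely many orthogonal copies of some `g ≠ 0`. In a maximal family of
such copies, comparing the remainder with `g` gives a nonzero central `z ≤ y` on which the remainder
is no larger than a subprojection of `g`; as the family is infinite, the pieces of `z` fit into it
twice (`exists_central_hasOrthogonalCopies`). A maximal family of such `z` exhausts `1`
(`hasOrthogonalCopies_one`).

No representation on a Hilbert space and no weak-⋆ continuity of the multiplication is needed. All
that is used of the predual is that closed balls are weak-⋆ compact and closed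
(`exists_ballLimit`). Since order intervals of self-adjoint elements are balls, this yields suprema
of bounded monotone nets, hence orthogonal sums and spectral projections
(`exists_isLUB_isStarProjection`). A partial sum `x` of partial isometries containing the summand
`w` satisfies `‖x‖ ≤ 1` and `‖x - 2 w‖ ≤ 1`; these conditions pass to the limit, and they force the
limit to agree with `w` on the initial projection of `w`, so that infinite sums of partial
isometries exist (`exists_sum_partialIsometry`).
-/

namespace CuntzW

open Filter Topology Metric

/-! ### Weak-⋆ limits and monotone completeness -/

section

variable {M : Type*} [CStarAlgebra M]

/-- A bounded family has, along any ultrafilter, a limit that lies in every closed ball containing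
eventually all of its members: closed balls are weak-⋆ compact and weak-⋆ closed. The predual enters
the argument only through this statement. -/
theorem exists_ballLimit [WStarAlgebra M] {ι : Type*} (l : Ultrafilter ι) (f : ι → M) (C : ℝ)
    (hf : ∀ i, ‖f i‖ ≤ C) :
    ∃ x : M, ∀ (c : M) (r : ℝ), (∀ᶠ i in l, ‖f i - c‖ ≤ r) → ‖x - c‖ ≤ r := by
  obtain ⟨X, _, _, _, ⟨φ⟩⟩ := WStarAlgebra.exists_predual (M := M)
  let g : ι → WeakDual ℂ X := fun i => StrongDual.toWeakDual (φ.symm (f i))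
  have hg : (l.map g : Filter (WeakDual ℂ X)) ≤
      𝓟 (WeakDual.toStrongDual ⁻¹' closedBall (0 : StrongDual ℂ X) C) := by
    rw [le_principal_iff, Ultrafilter.mem_coe, Ultrafilter.mem_map]
    refine Filter.univ_mem' fun i => ?_
    have : φ.symm (f i) ∈ closedBall (0 : StrongDual ℂ X) C := by
      rw [mem_closedBall_zero_iff, LinearIsometryEquiv.norm_map]
      exact hf i
    exact this
  obtain ⟨y, -, hy⟩ := (WeakDual.isCompact_closedBall (0 : StrongDual ℂ X) C).ultrafilter_le_nhds
    _ hg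
  refine ⟨φ (WeakDual.toStrongDual y), fun c r hc => ?_⟩
  have hmem : y ∈ (WeakDual.toStrongDual ⁻¹' closedBall (φ.symm c) r : Set (WeakDual ℂ X)) := by
    refine (WeakDual.isClosed_closedBall (φ.symm c) r).mem_of_tendsto
      (b := (l : Filter ι)) (f := g) hy ?_
    filter_upwards [hc] with i hi
    have : φ.symm (f i) ∈ closedBall (φ.symm c) r := by
      rw [mem_closedBall, dist_eq_norm, ← map_sub, LinearIsometryEquiv.norm_map]
      exact hi
    exact this
  have h2 : WeakDual.toStrongDual y ∈ closedBall (φ.symm c) r := hmem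
  rw [mem_closedBall, dist_eq_norm] at h2
  rw [← LinearIsometryEquiv.norm_map φ, map_sub, LinearIsometryEquiv.apply_symm_apply] at h2
  exact h2

/-- When the balls have self-adjoint centres, the limit can be replaced by its real part. -/
theorem exists_selfAdjoint_ballLimit [WStarAlgebra M] {ι : Type*} (l : Ultrafilter ι) (f : ι → M)
    (C : ℝ) (hf : ∀ i, ‖f i‖ ≤ C) :
    ∃ x : M, IsSelfAdjoint x ∧ ∀ (c : M) (r : ℝ), IsSelfAdjoint c →
      (∀ᶠ i in l, ‖f i - c‖ ≤ r) → ‖x - c‖ ≤ r := by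
  obtain ⟨x, hx⟩ := exists_ballLimit l f C hf
  refine ⟨(2⁻¹ : ℝ) • (x + star x), ?_, fun c r hc h => ?_⟩
  · rw [IsSelfAdjoint, star_smul, star_add, star_star, add_comm]
    simp
  · have h1 := hx c r h
    have h2 : ‖star x - c‖ ≤ r := by
      rw [← hc.star_eq, ← star_sub, norm_star]; exact h1
    have : (2⁻¹ : ℝ) • (x + star x) - c = (2⁻¹ : ℝ) • ((x - c) + (star x - c)) := by
      module
    rw [this, norm_smul]
    have := norm_add_le (x - c) (star x - c)
    norm_num
    linarith

variable [PartialOrder M] [StarOrderedRing M]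

theorem norm_le_iff_of_isSelfAdjoint {a : M} (ha : IsSelfAdjoint a) {r : ℝ} (hr : 0 ≤ r) :
    ‖a‖ ≤ r ↔ -algebraMap ℝ M r ≤ a ∧ a ≤ algebraMap ℝ M r := by
  refine ⟨fun h => ?_, fun ⟨h1, h2⟩ => ?_⟩
  · have := algebraMap_mono M h
    exact ⟨(neg_le_neg this).trans ha.neg_algebraMap_norm_le_self,
      ha.le_algebraMap_norm_self.trans this⟩
  · cases subsingleton_or_nontrivial M
    · simpa [Subsingleton.elim a 0] using hr
    · rw [← map_neg, algebraMap_le_iff_le_spectrum] at h1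
      rw [le_algebraMap_iff_spectrum_le] at h2
      rcases CStarAlgebra.norm_or_neg_norm_mem_spectrum ha with h | h
      · exact h2 _ h
      · linarith [h1 _ h]

/-- A W⋆-algebra is monotone complete; the bounds `0` and `1` are a normalisation. -/
theorem exists_isLUB_of_monotone [WStarAlgebra M] {ι : Type*} [Preorder ι] [IsDirectedOrder ι]
    [Nonempty ι] (f : ι → M) (hf : Monotone f) (h0 : ∀ i, 0 ≤ f i) (h1 : ∀ i, f i ≤ 1) :
    ∃ x, IsLUB (Set.range f) x := by
  let l : Ultrafilter ι := Ultrafilter.of atTop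
  have hl : (l : Filter ι) ≤ atTop := Ultrafilter.of_le _
  obtain ⟨x, hxs, hx⟩ := exists_selfAdjoint_ballLimit l f 1
    fun i => (CStarAlgebra.norm_le_one_iff_of_nonneg _ (h0 i)).2 (h1 i)
  -- an order interval of self-adjoint elements is a norm ball about its midpoint
  have key : ∀ (c : M) (K : ℝ), IsSelfAdjoint c → 0 ≤ K →
      (∀ᶠ i in atTop, c - algebraMap ℝ M K ≤ f i ∧ f i ≤ c + algebraMap ℝ M K) →
      c - algebraMap ℝ M K ≤ x ∧ x ≤ c + algebraMap ℝ M K := by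
    intro c K hc hK h
    have := hx c K hc (by
      filter_upwards [hl h] with i hi
      rw [norm_le_iff_of_isSelfAdjoint ((IsSelfAdjoint.of_nonneg (h0 i)).sub hc) hK]
      constructor
      · rw [neg_le_sub_iff_le_add]; simpa [add_comm] using sub_le_iff_le_add.1 hi.1
      · rw [sub_le_iff_le_add']; exact hi.2)
    rw [norm_le_iff_of_isSelfAdjoint (hxs.sub hc) hK] at this
    constructor
    · have := this.1
      rw [neg_le_sub_iff_le_add] at this
      exact sub_le_iff_le_add.2 (by simpa [add_comm] using this)
    · exact sub_le_iff_le_add'.1 this.2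
  have hsa : ∀ K : ℝ, IsSelfAdjoint (algebraMap ℝ M K) := fun K =>
    IsSelfAdjoint.algebraMap M (IsSelfAdjoint.all K)
  refine ⟨x, ?_, fun y hy => ?_⟩
  · rintro _ ⟨i, rfl⟩
    have h2 : algebraMap ℝ M (1/2) + algebraMap ℝ M (1/2) = 1 := by
      rw [← map_add]; norm_num
    have := (key (f i + algebraMap ℝ M (1/2)) (1/2) ((IsSelfAdjoint.of_nonneg (h0 i)).add (hsa _))
      (by norm_num) ?_).1
    · simpa using this
    · filter_upwards [eventually_ge_atTop i] with j hj
      refine ⟨by simpa using hf hj, ?_⟩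
      rw [add_assoc, h2]
      exact (h1 j).trans (le_add_of_nonneg_left (h0 i))
  · obtain ⟨i0⟩ := ‹Nonempty ι›
    have hy0 : 0 ≤ y := (h0 i0).trans (hy ⟨i0, rfl⟩)
    have hyn : y ≤ algebraMap ℝ M ‖y‖ := (IsSelfAdjoint.of_nonneg hy0).le_algebraMap_norm_self
    have h2 : algebraMap ℝ M (‖y‖/2) + algebraMap ℝ M (‖y‖/2) = algebraMap ℝ M ‖y‖ := by
      rw [← map_add]; simp
    have := (key (y - algebraMap ℝ M (‖y‖/2)) (‖y‖/2) ((IsSelfAdjoint.of_nonneg hy0).sub (hsa _))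
      (by positivity) ?_).2
    · simpa using this
    · refine Eventually.of_forall fun j => ⟨?_, by simpa using hy ⟨j, rfl⟩⟩
      rw [sub_sub, h2]
      exact (sub_nonpos.2 hyn).trans (h0 j)

/-- The supremum of a net of positive contractions is a projection if every member of the net has
another member acting on it as the identity. Moreover, whatever annihilates the net annihilates its
supremum; this replaces the weak-⋆ continuity of multiplication. -/
theorem exists_isLUB_isStarProjection [WStarAlgebra M] {ι : Type*} [Preorder ι]
    [IsDirectedOrder ι] [Nonempty ι] (f : ι → M) (hf : Monotone f) (h0 : ∀ i, 0 ≤ f i)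
    (h1 : ∀ i, f i ≤ 1) (hmul : ∀ i, ∃ j, f j * f i = f i) :
    ∃ p, IsStarProjection p ∧ IsLUB (Set.range f) p ∧ (∀ i, p * f i = f i) ∧
      ∀ y, (∀ i, y * f i = 0) → y * p = 0 := by
  obtain ⟨p, hp⟩ := exists_isLUB_of_monotone f hf h0 h1
  have hle : ∀ i, f i ≤ p := fun i => hp.1 ⟨i, rfl⟩
  obtain ⟨i0⟩ := ‹Nonempty ι›
  have hp0 : 0 ≤ p := (h0 i0).trans (hle i0)
  have hp1 : p ≤ 1 := hp.2 (by rintro _ ⟨i, rfl⟩; exact h1 i)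
  -- if `b` annihilates all `f i`, then `(1 - f i) (1 - b) ≥ 0` expands to `f i ≤ 1 - b`
  have key : ∀ b : M, 0 ≤ b → b ≤ 1 → (∀ i, b * f i = 0) → p ≤ 1 - b := by
    intro b hb0 hb1 hb
    refine hp.2 ?_
    rintro _ ⟨i, rfl⟩
    have hc : f i * b = 0 := by
      have := congrArg star (hb i)
      rwa [star_mul, star_zero, (IsSelfAdjoint.of_nonneg hb0).star_eq,
        (IsSelfAdjoint.of_nonneg (h0 i)).star_eq] at this
    have hcomm : Commute (1 - f i) (1 - b) := by
      simp only [commute_iff_eq, sub_mul, mul_sub, one_mul, mul_one, hb i, hc]; abel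
    have := Commute.mul_nonneg (sub_nonneg.2 (h1 i)) (sub_nonneg.2 hb1) hcomm
    simp only [sub_mul, mul_sub, one_mul, mul_one, hc] at this
    rw [← sub_nonneg]
    convert this using 1
    abel
  have hq0 : 0 ≤ 1 - p := sub_nonneg.2 hp1
  set b := CFC.sqrt (1 - p) with hbdef
  have hb0 : 0 ≤ b := CFC.sqrt_nonneg _
  have hbb : b * b = 1 - p := CFC.sqrt_mul_sqrt_self _ hq0
  have hb1 : b ≤ 1 := by
    have : ‖b‖ ≤ 1 := by
      have h := CStarRing.norm_star_mul_self (x := b)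
      rw [(IsSelfAdjoint.of_nonneg hb0).star_eq, hbb] at h
      have : ‖1 - p‖ ≤ 1 := (CStarAlgebra.norm_le_one_iff_of_nonneg _ hq0).2 (by simpa using hp0)
      nlinarith [norm_nonneg b]
    exact (CStarAlgebra.norm_le_one_iff_of_nonneg _ hb0).1 this
  have hbf : ∀ i, b * f i = 0 := by
    intro i
    obtain ⟨j, hj⟩ := hmul i
    have hfi := (IsSelfAdjoint.of_nonneg (h0 i)).star_eq
    have : star (b * f i) * (b * f i) = 0 := by
      have e1 : star (b * f i) * (b * f i) = star (f i) * (1 - p) * f i := by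
        rw [← hbb, star_mul, (IsSelfAdjoint.of_nonneg hb0).star_eq]; simp only [mul_assoc]
      have e2 : star (f i) * (1 - f j) * f i = 0 := by
        rw [mul_assoc, sub_mul, hj]; simp
      refine le_antisymm ?_ (star_mul_self_nonneg _)
      rw [e1, ← e2]
      exact star_left_conjugate_le_conjugate (sub_le_sub_left (hle j) _) _
    exact (CStarRing.star_mul_self_eq_zero_iff _).1 this
  -- `key` yields `b ≤ 1 - p = b²`, so that `b = b² = 1 - p` is a projection
  have hble : b ≤ b * b := by
    have := key b hb0 hb1 hbf
    rw [hbb]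
    exact le_sub_comm.1 this
  have hble' : b * b ≤ b := by
    have := Commute.mul_nonneg hb0 (sub_nonneg.2 hb1)
      (by simp only [commute_iff_eq, sub_mul, mul_sub, one_mul, mul_one])
    simpa [mul_sub] using this
  have hidem : b * b = b := le_antisymm hble' hble
  have hbp : IsStarProjection b := ⟨hidem, IsSelfAdjoint.of_nonneg hb0⟩
  have hpb : p = 1 - b := by rw [← hidem, hbb]; simp
  have hpp : IsStarProjection p := hpb ▸ hbp.one_sub
  refine ⟨p, hpp, hp, fun i => by rw [hpb, sub_mul, hbf, one_mul, sub_zero], fun y hy => ?_⟩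
  -- rescale `y⋆ y` to a contraction
  set K : ℝ := (‖y‖ ^ 2 + 1)⁻¹ with hK
  have hKpos : 0 < K := by positivity
  set c : M := K • (star y * y) with hc
  have hc0 : 0 ≤ c := smul_nonneg hKpos.le (star_mul_self_nonneg _)
  have hc1 : c ≤ 1 := by
    rw [← CStarAlgebra.norm_le_one_iff_of_nonneg _ hc0, hc, norm_smul,
      CStarRing.norm_star_mul_self, Real.norm_of_nonneg hKpos.le, hK,
      inv_mul_le_iff₀ (by positivity)]
    nlinarith
  have hpc := key c hc0 hc1 fun i => by rw [hc, smul_mul_assoc, mul_assoc, hy i]; simp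
  have hcp : c * p = 0 := by
    have := (hpp.one_sub.mul_right_and_mul_left_of_nonneg_of_le hc0
      (le_sub_comm.1 hpc)).1
    rw [← this, mul_assoc, hpp.one_sub_mul_self, mul_zero]
  have hyyp : star y * y * p = 0 := by
    rw [hc, smul_mul_assoc] at hcp
    exact (smul_eq_zero.1 hcp).resolve_left hKpos.ne'
  rw [← CStarRing.star_mul_self_eq_zero_iff, star_mul, mul_assoc, ← mul_assoc (star y), hyyp,
    mul_zero]

end

/-! ### Sums of projections and of partial isometries -/

section

section PartialIsometry

variable {M : Type*} [CStarAlgebra M]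

theorem mul_initial {u : M} (hu : IsStarProjection (star u * u)) : u * (star u * u) = u := by
  rw [← sub_eq_zero, ← CStarRing.star_mul_self_eq_zero_iff]
  have h := hu.isIdempotentElem.eq
  have e : star (u * (star u * u) - u) * (u * (star u * u) - u)
      = (star u * u) * (star u * u) * (star u * u) - (star u * u) * (star u * u)
        - ((star u * u) * (star u * u) - star u * u) := by
    simp only [star_sub, star_mul, star_star]
    noncomm_ring
  rw [e, h, h]; simp

theorem isStarProjection_final {u : M} (hu : IsStarProjection (star u * u)) :
    IsStarProjection (u * star u) := by
  refine ⟨?_, IsSelfAdjoint.mul_star_self u⟩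
  rw [IsIdempotentElem, mul_assoc, ← mul_assoc (star u), ← mul_assoc, mul_initial hu]

theorem final_mul {u : M} (hu : IsStarProjection (star u * u)) : u * star u * u = u := by
  rw [mul_assoc, mul_initial hu]

theorem mul_eq_zero_of_mul_mul_star {u y : M} (h : y * (u * star u) = 0) : y * u = 0 := by
  rw [← CStarRing.mul_star_self_eq_zero_iff, star_mul, mul_assoc, ← mul_assoc u, ← mul_assoc, h,
    zero_mul]

theorem initial_mul_initial {u v : M} (h : u * star v = 0) :
    star u * u * (star v * v) = 0 := by
  rw [mul_assoc, ← mul_assoc u, h, zero_mul, mul_zero]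

theorem final_mul_final {u v : M} (h : star u * v = 0) : u * star u * (v * star v) = 0 := by
  rw [mul_assoc, ← mul_assoc (star u), h, zero_mul, mul_zero]

theorem mul_eq_self_iff_of_isStarProjection {p x : M} (hp : IsStarProjection p) :
    x * p = x ↔ p * star x = star x := by
  rw [← star_inj, star_mul, hp.isSelfAdjoint.star_eq]

theorem isStarProjection_sum {ι : Type*} {e : ι → M} (he : ∀ i, IsStarProjection (e i))
    (ho : Pairwise fun i j => e i * e j = 0) (F : Finset ι) :
    IsStarProjection (∑ i ∈ F, e i) := by
  classical
  induction F using Finset.induction_on with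
  | empty => simp [IsStarProjection.zero M]
  | insert a F ha ih =>
    rw [Finset.sum_insert ha]
    refine (he a).add ih ?_
    rw [Finset.mul_sum]
    exact Finset.sum_eq_zero fun i hi => ho (by rintro rfl; exact ha hi)

theorem norm_sum_le_one {ι : Type*} {u : ι → M} (hu : ∀ i, IsStarProjection (star (u i) * u i))
    (h1 : Pairwise fun i j => star (u i) * u j = 0)
    (h2 : Pairwise fun i j => u i * star (u j) = 0) (F : Finset ι) :
    ‖∑ i ∈ F, u i‖ ≤ 1 := by
  have e : star (∑ i ∈ F, u i) * (∑ i ∈ F, u i) = ∑ i ∈ F, star (u i) * u i := by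
    rw [star_sum, Finset.sum_mul]
    refine Finset.sum_congr rfl fun i hi => ?_
    rw [Finset.mul_sum]
    exact Finset.sum_eq_single i (fun j _ hj => h1 hj.symm) fun h => (h hi).elim
  have hn := CStarRing.norm_star_mul_self (x := ∑ i ∈ F, u i)
  have := (isStarProjection_sum hu (fun _ _ hij => initial_mul_initial (h2 hij)) F).norm_le
  rw [e] at hn
  nlinarith [norm_nonneg (∑ i ∈ F, u i)]

variable [PartialOrder M] [StarOrderedRing M]

theorem star_mul_self_le_one {x : M} (h : ‖x‖ ≤ 1) : star x * x ≤ 1 := by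
  rw [← CStarAlgebra.norm_le_one_iff_of_nonneg _ (star_mul_self_nonneg x),
    CStarRing.norm_star_mul_self]
  nlinarith [norm_nonneg x]

theorem mul_eq_zero_of_conjugate {z y : M} (hz : 0 ≤ z) (h : star y * z * y = 0) :
    z * y = 0 := by
  have hs := CFC.sqrt_mul_sqrt_self z hz
  have : CFC.sqrt z * y = 0 := by
    rw [← CStarRing.star_mul_self_eq_zero_iff, star_mul,
      (IsSelfAdjoint.of_nonneg (CFC.sqrt_nonneg z)).star_eq, ← h]
    conv_rhs => rw [← hs]
    simp only [mul_assoc]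
  rw [← hs, mul_assoc, this, mul_zero]

/-- A contraction `x` such that `x - 2 w` is a contraction too agrees with the partial isometry `w`
on its initial projection: `d = x - w` satisfies `d⋆ d + w⋆ w ≤ 1`. -/
theorem mul_initial_eq_of_norm_le {x w : M} (hw : IsStarProjection (star w * w)) (h1 : ‖x‖ ≤ 1)
    (h2 : ‖x - (2 : ℝ) • w‖ ≤ 1) : x * (star w * w) = w := by
  set d := x - w with hd
  set p := star w * w with hp
  -- parallelogram identity for `d + w` and `d - w`
  have hpar : star d * d + p ≤ 1 := by
    have a1 := star_mul_self_le_one h1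
    have a2 := star_mul_self_le_one h2
    have e : star d * d + p = (2⁻¹ : ℝ) • (star x * x +
        star (x - (2 : ℝ) • w) * (x - (2 : ℝ) • w)) := by
      simp only [hd, hp, star_sub, star_smul, star_trivial, sub_mul, mul_sub, smul_mul_assoc,
        mul_smul_comm]
      module
    rw [e]
    calc _ ≤ (2⁻¹ : ℝ) • ((1 : M) + 1) :=
          smul_le_smul_of_nonneg_left (add_le_add a1 a2) (by norm_num)
      _ = 1 := by rw [← two_smul ℝ (1 : M), smul_smul]; norm_num
  have hdp : d * p = 0 := by
    rw [← CStarRing.star_mul_self_eq_zero_iff]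
    refine le_antisymm ?_ (star_mul_self_nonneg _)
    have := star_left_conjugate_le_conjugate hpar p
    have e : star p * (star d * d + p) * p = star (d * p) * (d * p) + p := by
      have hi := hw.isIdempotentElem.eq
      rw [star_mul d p, mul_add, add_mul, hw.isSelfAdjoint.star_eq, hi, hi]
      simp only [mul_assoc]
    rw [e, mul_one, hw.isSelfAdjoint.star_eq, hw.isIdempotentElem.eq] at this
    simpa using this
  rw [hd, sub_mul, hp, mul_initial hw, sub_eq_zero] at hdp
  exact hdp

end PartialIsometry

variable {M : Type*} [CStarAlgebra M]

/-- The projection `p` is the sum of the family of projections `e`, expressed multiplicatively: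
`p` dominates each `e i`, and is annihilated from the left by whatever annihilates all `e i`. For
pairwise orthogonal projections in a W⋆-algebra, such a `p` is exactly the least upper bound of the
finite partial sums; see `IsOrthSum.isLUB`. -/
structure IsOrthSum {ι : Type*} (e : ι → M) (p : M) : Prop where
  proj : IsStarProjection p
  mul_eq : ∀ i, p * e i = e i
  mul_eq_zero : ∀ y, (∀ i, y * e i = 0) → y * p = 0

theorem IsOrthSum.mul_left_eq {ι : Type*} {e : ι → M} {p : M} (hp : IsOrthSum e p) {r : M}
    (hr : ∀ i, r * e i = e i) : r * p = p := by
  have := hp.mul_eq_zero (1 - r) fun i => by rw [sub_mul, hr, one_mul, sub_self]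
  rw [sub_mul, one_mul, sub_eq_zero] at this
  exact this.symm

theorem IsOrthSum.unique {ι : Type*} {e : ι → M} {p q : M} (hp : IsOrthSum e p)
    (hq : IsOrthSum e q) : p = q := by
  have h1 := congrArg star (hp.mul_left_eq hq.mul_eq)
  rw [star_mul, hp.proj.isSelfAdjoint.star_eq, hq.proj.isSelfAdjoint.star_eq] at h1
  rw [← h1, hq.mul_left_eq hp.mul_eq]

theorem IsOrthSum.eq_mul {ι : Type*} {e : ι → M} {p : M} (hp : IsOrthSum e p)
    (he : ∀ i, IsStarProjection (e i)) (i : ι) : e i * p = e i := by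
  have := congrArg star (hp.mul_eq i)
  rwa [star_mul, hp.proj.isSelfAdjoint.star_eq, (he i).isSelfAdjoint.star_eq] at this

theorem IsOrthSum.mul_eq_zero' {ι : Type*} {e : ι → M} {p : M} (hp : IsOrthSum e p)
    (he : ∀ i, IsStarProjection (e i)) {y : M} (hy : ∀ i, e i * y = 0) : p * y = 0 := by
  have := hp.mul_eq_zero (star y) fun i => by
    have := congrArg star (hy i)
    rwa [star_mul, (he i).isSelfAdjoint.star_eq, star_zero] at this
  have := congrArg star this
  rwa [star_mul, hp.proj.isSelfAdjoint.star_eq, star_star, star_zero] at this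

variable [PartialOrder M] [StarOrderedRing M]

theorem exists_isOrthSum_isLUB [WStarAlgebra M] {ι : Type*} {e : ι → M}
    (he : ∀ i, IsStarProjection (e i)) (ho : Pairwise fun i j => e i * e j = 0) :
    ∃ p, IsOrthSum e p ∧ IsLUB (Set.range fun F : Finset ι => ∑ i ∈ F, e i) p := by
  classical
  have hs := isStarProjection_sum he ho
  obtain ⟨p, h1, h2, h3, h4⟩ := exists_isLUB_isStarProjection (fun F : Finset ι => ∑ i ∈ F, e i)
    (fun F G h => Finset.sum_le_sum_of_subset_of_nonneg h fun i _ _ => (he i).nonneg)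
    (fun F => (hs F).nonneg) (fun F => (hs F).le_one)
    (fun F => ⟨F, (hs F).isIdempotentElem⟩)
  refine ⟨p, ⟨h1, fun i => by simpa using h3 {i}, fun y hy => h4 y fun F => ?_⟩, h2⟩
  rw [Finset.mul_sum]
  exact Finset.sum_eq_zero fun i _ => hy i

theorem exists_isOrthSum [WStarAlgebra M] {ι : Type*} {e : ι → M}
    (he : ∀ i, IsStarProjection (e i)) (ho : Pairwise fun i j => e i * e j = 0) :
    ∃ p, IsOrthSum e p :=
  (exists_isOrthSum_isLUB he ho).imp fun _ h => h.1

theorem IsOrthSum.isLUB [WStarAlgebra M] {ι : Type*} {e : ι → M} {p : M} (hp : IsOrthSum e p)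
    (he : ∀ i, IsStarProjection (e i)) (ho : Pairwise fun i j => e i * e j = 0) :
    IsLUB (Set.range fun F : Finset ι => ∑ i ∈ F, e i) p := by
  obtain ⟨q, hq, hl⟩ := exists_isOrthSum_isLUB he ho
  rwa [hp.unique hq]

/-- Partial isometries with orthogonal initial and orthogonal final projections can be added up:
there is a partial isometry from the sum of the initial projections onto the sum of the final ones.
-/
theorem exists_sum_partialIsometry [WStarAlgebra M] {ι : Type*} {u : ι → M}
    (hu : ∀ i, IsStarProjection (star (u i) * u i))
    (h1 : Pairwise fun i j => star (u i) * u j = 0)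
    (h2 : Pairwise fun i j => u i * star (u j) = 0) {p q : M}
    (hp : IsOrthSum (fun i => star (u i) * u i) p)
    (hq : IsOrthSum (fun i => u i * star (u i)) q) :
    ∃ v, star v * v = p ∧ v * star v = q := by
  classical
  let l : Ultrafilter (Finset ι) := Ultrafilter.of atTop
  have hl : (l : Filter (Finset ι)) ≤ atTop := Ultrafilter.of_le _
  have hn := norm_sum_le_one hu h1 h2
  obtain ⟨x, hx⟩ := exists_ballLimit l (fun F : Finset ι => ∑ i ∈ F, u i) 1 hn
  have hx1 : ‖x‖ ≤ 1 := by
    simpa using hx 0 1 (Eventually.of_forall fun F => by simpa using hn F)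
  have hx2 : ∀ a, ‖x - (2 : ℝ) • u a‖ ≤ 1 := by
    intro a
    refine hx _ 1 (hl ?_)
    filter_upwards [eventually_ge_atTop {a}] with F hF
    have haF : a ∈ F := hF (Finset.mem_singleton_self a)
    -- flipping the sign of one summand gives a family of the same kind
    let c : ι → ℝ := fun i => if i = a then -1 else 1
    have hc : ∀ i, c i * c i = 1 := fun i => by by_cases h : i = a <;> simp [c, h]
    have := norm_sum_le_one (u := fun i => c i • u i)
      (fun i => by simp [smul_smul, hc, hu i])
      (fun i j hij => by simp [h1 hij]) (fun i j hij => by simp [h2 hij]) F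
    convert this using 2
    rw [← Finset.add_sum_erase F u haF, ← Finset.add_sum_erase F _ haF]
    have : ∑ i ∈ F.erase a, c i • u i = ∑ i ∈ F.erase a, u i :=
      Finset.sum_congr rfl fun i hi => by simp [c, Finset.ne_of_mem_erase hi]
    rw [this]
    simp only [c, if_true]
    module
  have hxu : ∀ a, x * (star (u a) * u a) = u a := fun a =>
    mul_initial_eq_of_norm_le (hu a) hx1 (hx2 a)
  -- nothing is known about `x` on the complement of `p`, so pass to `x p`
  have hvu : ∀ a, x * p * (star (u a) * u a) = u a := fun a => by
    rw [mul_assoc, hp.mul_eq, hxu]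
  have hxp : star x * x * p = p := by
    rw [← sub_eq_zero, ← neg_eq_zero, neg_sub]
    have : (1 - star x * x) * p = 0 := hp.mul_eq_zero _ fun a => by
      refine mul_eq_zero_of_conjugate (sub_nonneg.2 (star_mul_self_le_one hx1)) ?_
      have hi := (hu a).isIdempotentElem.eq
      have : star (star (u a) * u a) * (star x * x) * (star (u a) * u a)
          = star (x * (star (u a) * u a)) * (x * (star (u a) * u a)) := by
        rw [star_mul x]; simp only [mul_assoc]
      rw [mul_sub, sub_mul, this, hxu, mul_one, (hu a).isSelfAdjoint.star_eq, hi, sub_self]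
    rwa [sub_mul, one_mul] at this
  have hv : star (x * p) * (x * p) = p := by
    rw [star_mul, mul_assoc, ← mul_assoc (star x), hxp, hp.proj.isSelfAdjoint.star_eq,
      hp.proj.isIdempotentElem.eq]
  have hf := isStarProjection_final (hv.symm ▸ hp.proj)
  refine ⟨x * p, hv, ?_⟩
  refine IsOrthSum.unique (e := fun i => u i * star (u i)) ⟨hf, fun a => ?_, fun y hy => ?_⟩ hq
  · have e : star (x * p) * u a = star (u a) * u a := by
      conv_lhs => rw [← hvu a]
      rw [← mul_assoc, hv, hp.mul_eq]
    show x * p * star (x * p) * (u a * star (u a)) = _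
    rw [← mul_assoc, mul_assoc (x * p), e, hvu]
  · have e : y * (x * p) * p = 0 := hp.mul_eq_zero _ fun a => by
      rw [mul_assoc, hvu]
      exact mul_eq_zero_of_mul_mul_star (hy a)
    rw [← mul_assoc]
    rw [mul_assoc, mul_assoc, hp.proj.isIdempotentElem.eq] at e
    rw [e, zero_mul]

end

/-! ### Partial isometries from the continuous functional calculus -/

section

variable {M : Type*} [CStarAlgebra M] [PartialOrder M] [StarOrderedRing M]

/-- A continuous function that vanishes on `t ≤ ε` and increases with `n` to the indicator function
of `t > ε`, chosen so that `ramp ε (n + 1) = 1` wherever `ramp ε n ≠ 0`. -/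
noncomputable def ramp (ε : ℝ) (n : ℕ) (t : ℝ) : ℝ := max 0 (min 1 ((t / ε - 1) * 2 ^ n - 1))

theorem continuous_ramp (ε : ℝ) (n : ℕ) : Continuous (ramp ε n) := by
  unfold ramp; fun_prop

theorem ramp_nonneg (ε : ℝ) (n : ℕ) (t : ℝ) : 0 ≤ ramp ε n t := le_max_left _ _

theorem ramp_le_one (ε : ℝ) (n : ℕ) (t : ℝ) : ramp ε n t ≤ 1 :=
  max_le zero_le_one (min_le_left _ _)

theorem ramp_eq_zero {ε : ℝ} {n : ℕ} {t : ℝ} (h : t / ε - 1 ≤ 0) : ramp ε n t = 0 := by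
  have : (t / ε - 1) * 2 ^ n ≤ 0 := mul_nonpos_of_nonpos_of_nonneg h (by positivity)
  exact max_eq_left ((min_le_right _ _).trans (by linarith))

theorem ramp_mono (ε : ℝ) (t : ℝ) : Monotone fun n => ramp ε n t := by
  intro m n hmn
  rcases le_total (t / ε - 1) 0 with h | h
  · simp [ramp_eq_zero h]
  · have : (2 : ℝ) ^ m ≤ 2 ^ n := pow_le_pow_right₀ (by norm_num) hmn
    have := mul_le_mul_of_nonneg_left this h
    exact max_le_max le_rfl (min_le_min le_rfl (by linarith))

theorem ramp_succ_mul (ε : ℝ) (n : ℕ) (t : ℝ) : ramp ε (n + 1) t * ramp ε n t = ramp ε n t := by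
  rcases le_total ((t / ε - 1) * 2 ^ n - 1) 0 with h | h
  · have : ramp ε n t = 0 := max_eq_left ((min_le_right _ _).trans h)
    simp [this]
  · have : ramp ε (n + 1) t = 1 := by
      have : 1 ≤ (t / ε - 1) * 2 ^ (n + 1) - 1 := by rw [pow_succ]; linarith
      simp [ramp, min_eq_left this]
    rw [this, one_mul]

/-- A weak form of the polar decomposition: some cut-down `u = x y` of a nonzero `x` is a nonzero
partial isometry. It lives on the spectral projection `p` of `a = x⋆ x` for the half-line `(ε, ∞)`
with `ε = ‖a‖ / 2`, where `u = x a^(-1/2) p`. -/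
theorem exists_partialIsometry_of_ne_zero [WStarAlgebra M] {x : M} (hx : x ≠ 0) :
    ∃ u : M, u ≠ 0 ∧ IsStarProjection (star u * u) ∧ (∃ y, u = x * y) ∧ ∃ w, u = w * x := by
  have : Nontrivial M := ⟨x, 0, hx⟩
  set a := star x * x with ha
  have ha0 : 0 ≤ a := star_mul_self_nonneg x
  have has : IsSelfAdjoint a := .of_nonneg ha0
  have hane : a ≠ 0 := fun h => hx ((CStarRing.star_mul_self_eq_zero_iff x).1 h)
  set ε := ‖a‖ / 2 with hε
  have hε0 : 0 < ε := half_pos (norm_pos_iff.2 hane)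
  have hcont : ∀ n, ContinuousOn (ramp ε n) (spectrum ℝ a) := fun n =>
    (continuous_ramp ε n).continuousOn
  let f : ℕ → M := fun n => cfc (ramp ε n) a
  obtain ⟨p, hp, hlub, hpf, hp0⟩ := exists_isLUB_isStarProjection f
    (fun m n hmn => cfc_mono (fun t _ => ramp_mono ε t hmn) (hcont m) (hcont n))
    (fun n => cfc_nonneg fun t _ => ramp_nonneg ε n t)
    (fun n => cfc_le_one _ _ fun t _ => ramp_le_one ε n t)
    (fun n => ⟨n + 1, by
      simp only [f]
      rw [← cfc_mul _ _ a (hcont _) (hcont _)]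
      exact congrArg (fun g => cfc g a) (funext fun t => ramp_succ_mul ε n t)⟩)
  have hpne : p ≠ 0 := by
    rintro rfl
    have h1 : f 1 = 0 := by rw [← hpf 1, zero_mul]
    have h2 : ramp ε 1 ‖a‖ ∈ spectrum ℝ (cfc (ramp ε 1) a) := by
      rw [cfc_map_spectrum (ramp ε 1) a (hf := hcont 1)]
      exact ⟨_, CStarAlgebra.norm_mem_spectrum_of_nonneg ha0, rfl⟩
    have h3 : ramp ε 1 ‖a‖ = 1 := by
      have : ‖a‖ / ε = 2 := by rw [hε]; field_simp [norm_ne_zero_iff.2 hane]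
      rw [ramp, this]; norm_num
    change cfc (ramp ε 1) a = 0 at h1
    rw [h1, h3, spectrum.zero_eq] at h2
    simp at h2
  let k : ℝ → ℝ := fun t => (Real.sqrt (max t ε))⁻¹
  have hmax : ∀ t, 0 < max t ε := fun t => lt_max_of_lt_right hε0
  have hk : Continuous k := by
    refine Continuous.inv₀ (by fun_prop) fun t => (Real.sqrt_pos.2 (hmax t)).ne'
  have hkk : ∀ t, k t * k t = (max t ε)⁻¹ := fun t => by
    simp only [k]; rw [← mul_inv, Real.mul_self_sqrt (hmax t).le]
  set c := cfc k a with hc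
  have hcs : star c = c := (cfc_predicate k a : IsSelfAdjoint _).star_eq
  -- `c² a` acts as the identity on `p`
  have hcac : ∀ n, c * c * a * f n = f n := by
    intro n
    have : c * c * a * f n = cfc (fun t => k t * k t * t * ramp ε n t) a := by
      rw [cfc_mul (fun t => k t * k t * t) _ a (by fun_prop) (hcont n),
        cfc_mul (fun t => k t * k t) _ a (by fun_prop) (by fun_prop),
        cfc_mul k k a (by fun_prop) (by fun_prop), cfc_id' ℝ a]
    rw [this]
    refine congrArg (fun g => cfc g a) (funext fun t => ?_)
    rcases le_total (t / ε - 1) 0 with h | h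
    · rw [ramp_eq_zero h, mul_zero]
    · have : ε ≤ t := by
        rw [sub_nonneg, le_div_iff₀ hε0, one_mul] at h; exact h
      rw [hkk, max_eq_left this, inv_mul_cancel₀ (hε0.trans_le this).ne', one_mul]
  have hcomm : a * c = c * a := by
    have := (cfc_commute_cfc id k a).eq
    rwa [cfc_id ℝ a] at this
  have hccap : c * c * a * p = p := by
    have : (1 - c * c * a) * p = 0 := hp0 _ fun n => by rw [sub_mul, hcac]; simp
    rw [sub_mul, one_mul, sub_eq_zero] at this
    exact this.symm
  have hpacc : p * (c * c) * a = p := by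
    have := congrArg star hccap
    simp only [star_mul, hcs, hp.isSelfAdjoint.star_eq, has.star_eq] at this
    rw [mul_assoc]
    convert this using 2
    rw [mul_assoc, ← hcomm, ← mul_assoc, ← hcomm, mul_assoc]
  have huu : star (x * c * p) * (x * c * p) = p := by
    simp only [star_mul, hcs, hp.isSelfAdjoint.star_eq]
    have : p * (c * star x) * (x * c * p) = p * (c * (a * c) * p) := by
      simp only [ha, mul_assoc]
    rw [this, hcomm, ← mul_assoc c, hccap, hp.isIdempotentElem.eq]
  refine ⟨x * c * p, ?_, huu.symm ▸ hp, ⟨c * p, mul_assoc _ _ _⟩,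
    ⟨x * c * (p * (c * c)) * star x, ?_⟩⟩
  · intro h
    rw [h] at huu
    exact hpne (by simpa using huu.symm)
  · rw [mul_assoc _ (star x) x, ← ha, mul_assoc _ _ a, hpacc]

/-- If `g M r ≠ 0`, then some nonzero subprojection of `r` is equivalent to a subprojection
of `g`. -/
theorem exists_partialIsometry_between [WStarAlgebra M] {g r x : M} (hg : IsStarProjection g)
    (hr : IsStarProjection r) (hx : g * x * r ≠ 0) :
    ∃ u : M, u ≠ 0 ∧ IsStarProjection (star u * u) ∧ g * u = u ∧ u * r = u := by
  obtain ⟨u, hu0, hui, ⟨y, hy⟩, ⟨w, hw⟩⟩ := exists_partialIsometry_of_ne_zero hx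
  refine ⟨u, hu0, hui, ?_, ?_⟩
  · rw [hy, ← mul_assoc, ← mul_assoc, ← mul_assoc, hg.isIdempotentElem.eq]
  · rw [hw, mul_assoc, mul_assoc, hr.isIdempotentElem.eq]

end

/-! ### Comparison and central covers -/

section

/-- The form of Zorn's lemma used for families of pairwise orthogonal elements. An element
orthogonal to the whole maximal family belongs to it, hence is orthogonal to itself. -/
theorem exists_maximal_pairwise {α : Type*} (P : α → Prop) (R : α → α → Prop) {S₀ : Set α}
    (h₀ : ∀ x ∈ S₀, P x) (h₀' : S₀.Pairwise R) :
    ∃ S, S₀ ⊆ S ∧ (∀ x ∈ S, P x) ∧ S.Pairwise R ∧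
      ∀ x, P x → (∀ y ∈ S, R x y ∧ R y x) → x ∈ S := by
  obtain ⟨S, hS, hmax⟩ := zorn_subset_nonempty {S : Set α | (∀ x ∈ S, P x) ∧ S.Pairwise R}
    (fun c hc hchain _ => ⟨⋃₀ c, ⟨fun x ⟨s, hs, hx⟩ => (hc hs).1 x hx,
      (Set.pairwise_sUnion hchain.directedOn).2 fun s hs => (hc hs).2⟩,
      fun s hs => Set.subset_sUnion_of_mem hs⟩) S₀ ⟨h₀, h₀'⟩
  refine ⟨S, hS, hmax.prop.1, hmax.prop.2, fun x hx hxS => ?_⟩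
  have : insert x S ∈ {S : Set α | (∀ x ∈ S, P x) ∧ S.Pairwise R} :=
    ⟨by rintro y (rfl | hy); exacts [hx, hmax.prop.1 y hy],
      hmax.prop.2.insert fun y hy _ => hxS y hy⟩
  exact hmax.le_of_ge this (Set.subset_insert x S) (Set.mem_insert x S)

theorem mem_center_of_forall_one_sub_mul {M : Type*} [CStarAlgebra M] {z : M}
    (hz : IsStarProjection z) (h : ∀ x, (1 - z) * x * z = 0) : z ∈ Set.center M := by
  refine Semigroup.mem_center_iff.2 fun x => ?_
  have a1 := h x
  have a2 := congrArg star (h (star x))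
  simp only [star_mul, star_sub, star_one, star_star, star_zero, hz.isSelfAdjoint.star_eq] at a2
  rw [sub_mul, sub_mul, one_mul, sub_eq_zero] at a1
  rw [mul_sub, mul_sub, mul_one, sub_eq_zero, ← mul_assoc] at a2
  rw [a1, ← a2]

variable {M : Type*} [CStarAlgebra M] [PartialOrder M] [StarOrderedRing M]

/-- A partial isometry from a part of `r` to a part of `g` that cannot be enlarged, as the parts
left over have no nonzero equivalent subprojections. Together with `exists_central_separation` this
is the comparison theorem. -/
theorem exists_maximal_partialIsometry [WStarAlgebra M] {r g : M} (hr : IsStarProjection r)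
    (hg : IsStarProjection g) :
    ∃ w : M, IsStarProjection (star w * w) ∧ w * r = w ∧ g * w = w ∧
      ∀ x, (g - w * star w) * x * (r - star w * w) = 0 := by
  obtain ⟨S, -, hP, hR, hmax⟩ := exists_maximal_pairwise
    (fun u : M => u ≠ 0 ∧ IsStarProjection (star u * u) ∧ u * r = u ∧ g * u = u)
    (fun u v => star u * v = 0 ∧ u * star v = 0) (S₀ := ∅) (by simp) (by simp)
  have hi : ∀ u : S, IsStarProjection (star u.1 * u.1) := fun u => (hP u u.2).2.1
  have hf : ∀ u : S, IsStarProjection (u.1 * star u.1) := fun u => isStarProjection_final (hi u)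
  have h1 : Pairwise fun u v : S => star u.1 * v.1 = 0 := fun u v huv =>
    (hR u.2 v.2 (Subtype.coe_injective.ne huv)).1
  have h2 : Pairwise fun u v : S => u.1 * star v.1 = 0 := fun u v huv =>
    (hR u.2 v.2 (Subtype.coe_injective.ne huv)).2
  obtain ⟨p, hp⟩ := exists_isOrthSum hi fun _ _ huv => initial_mul_initial (h2 huv)
  obtain ⟨q, hq⟩ := exists_isOrthSum hf fun _ _ huv => final_mul_final (h1 huv)
  obtain ⟨w, hwp, hwq⟩ := exists_sum_partialIsometry hi h1 h2 hp hq
  have hrp : r * p = p := hp.mul_left_eq fun u => by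
    rw [← mul_assoc, (mul_eq_self_iff_of_isStarProjection hr).1 (hP u u.2).2.2.1]
  have hgq : g * q = q := hq.mul_left_eq fun u => by rw [← mul_assoc, (hP u u.2).2.2.2]
  have hpr : p * r = p := by
    rw [mul_eq_self_iff_of_isStarProjection hr, hp.proj.isSelfAdjoint.star_eq, hrp]
  have hqg : q * g = q := by
    rw [mul_eq_self_iff_of_isStarProjection hg, hq.proj.isSelfAdjoint.star_eq, hgq]
  have hwi : IsStarProjection (star w * w) := hwp.symm ▸ hp.proj
  refine ⟨w, hwi, ?_, ?_, fun x => ?_⟩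
  · rw [← mul_initial hwi, hwp, mul_assoc, hpr]
  · rw [← final_mul hwi, hwq, ← mul_assoc, hgq]
  · by_contra hne
    rw [hwp, hwq] at hne
    obtain ⟨u, hu0, hui, hgu', hur'⟩ := exists_partialIsometry_between
      (hq.proj.sub_of_mul_eq_left hg hqg) (hp.proj.sub_of_mul_eq_left hr hpr) hne
    have hqu : q * u = 0 := by
      rw [← hgu', ← mul_assoc, mul_sub, hqg, hq.proj.isIdempotentElem.eq, sub_self, zero_mul]
    have hup : u * p = 0 := by
      rw [← hur', mul_assoc, sub_mul, hrp, hp.proj.isIdempotentElem.eq, sub_self, mul_zero]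
    have hgu : g * u = u := by
      rw [← hgu', ← mul_assoc, mul_sub, hgq, hg.isIdempotentElem.eq]
    have hur : u * r = u := by
      rw [← hur', mul_assoc, sub_mul, hpr, hr.isIdempotentElem.eq]
    have hqv : ∀ v ∈ S, star v * u = 0 := fun v hv => by
      have h : q * v = v := by
        rw [← final_mul (hP v hv).2.1, ← mul_assoc, hq.mul_eq ⟨v, hv⟩]
      have := congrArg star h
      rw [star_mul, hq.proj.isSelfAdjoint.star_eq] at this
      rw [← this, mul_assoc, hqu, mul_zero]
    have hpv : ∀ v ∈ S, u * star v = 0 := fun v hv => by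
      have h : v * p = v := by
        rw [← mul_initial (hP v hv).2.1, mul_assoc, hp.eq_mul hi ⟨v, hv⟩]
      rw [← (mul_eq_self_iff_of_isStarProjection hp.proj).1 h, ← mul_assoc, hup, zero_mul]
    have huS := hmax u ⟨hu0, hui, hur, hgu⟩ fun v hv =>
      ⟨⟨by simpa using congrArg star (hqv v hv), hpv v hv⟩,
        ⟨hqv v hv, by simpa using congrArg star (hpv v hv)⟩⟩
    exact hu0 ((CStarRing.star_mul_self_eq_zero_iff u).1 (hqv u huS))

/-- If `g M r = 0`, then a central projection dominates `g` and annihilates `r`. It is the central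
cover of `g`, built as the sum of a maximal orthogonal family of projections equivalent to
subprojections of `g`. -/
theorem exists_central_separation [WStarAlgebra M] {g r : M} (hg : IsStarProjection g)
    (h : ∀ x, g * x * r = 0) :
    ∃ z : M, IsStarProjection z ∧ z ∈ Set.center M ∧ z * g = g ∧ z * r = 0 := by
  obtain ⟨S, -, hP, hR, hmax⟩ := exists_maximal_pairwise
    (fun u : M => u ≠ 0 ∧ IsStarProjection (star u * u) ∧ u * g = u)
    (fun u v => star u * v = 0) (S₀ := ∅) (by simp) (by simp)
  have hf : ∀ u : S, IsStarProjection (u.1 * star u.1) := fun u =>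
    isStarProjection_final (hP u u.2).2.1
  obtain ⟨z, hz⟩ := exists_isOrthSum hf fun u v huv =>
    final_mul_final (hR u.2 v.2 (Subtype.coe_injective.ne huv))
  have hzs := hz.proj.isSelfAdjoint.star_eq
  have key : ∀ x, (1 - z) * x * g = 0 := by
    intro x
    by_contra hne
    obtain ⟨u, hu0, hui, hzu', hug⟩ := exists_partialIsometry_between hz.proj.one_sub hg hne
    have hzu : z * u = 0 := by
      rw [← hzu', ← mul_assoc, hz.proj.mul_one_sub_self, zero_mul]
    have hqv : ∀ v ∈ S, star v * u = 0 := fun v hv => by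
      have h : z * v = v := by
        rw [← final_mul (hP v hv).2.1, ← mul_assoc, hz.mul_eq ⟨v, hv⟩]
      have := congrArg star h
      rw [star_mul, hzs] at this
      rw [← this, mul_assoc, hzu, mul_zero]
    have huS := hmax u ⟨hu0, hui, hug⟩ fun v hv =>
      ⟨by simpa using congrArg star (hqv v hv), hqv v hv⟩
    exact hu0 ((CStarRing.star_mul_self_eq_zero_iff u).1 (hqv u huS))
  have hoff : ∀ x, (1 - z) * x * z = 0 := fun x => hz.mul_eq_zero _ fun u => by
    rw [← (hP u u.2).2.2, ← mul_assoc, ← mul_assoc, mul_assoc (1 - z), key, zero_mul]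
  refine ⟨z, hz.proj, mem_center_of_forall_one_sub_mul hz.proj hoff, ?_, ?_⟩
  · have := key 1
    rw [mul_one, sub_mul, one_mul, sub_eq_zero] at this
    exact this.symm
  · refine hz.mul_eq_zero' hf fun u => ?_
    have : star u.1 = g * star u.1 :=
      ((mul_eq_self_iff_of_isStarProjection hg).1 (hP u u.2).2.2).symm
    rw [this, mul_assoc, mul_assoc, ← mul_assoc g, h, mul_zero]

end

/-! ### Two orthogonal copies of the unit -/

section

/-- Let `v` be an isometry of `y`, that is `v⋆ v = y` and `y v = v`. The powers of `v` move an
element `x` of `y M` whose range is orthogonal to that of `v` to pairwise orthogonal places. -/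
theorem orthogonal_translates {M : Type*} [CStarAlgebra M] {y v x : M}
    (hv : star v * v = y) (hyv : y * v = v) (hyx : y * x = x) (hxv : star x * v = 0) :
    (∀ n : ℕ, y * (v ^ n * x) = v ^ n * x) ∧
      (∀ n : ℕ, star (v ^ n * x) * (v ^ n * x) = star x * x) ∧
      Pairwise fun m n : ℕ => star (v ^ m * x) * (v ^ n * x) = 0 := by
  have ws : ∀ n : ℕ, v ^ (n + 1) * x = v * (v ^ n * x) := fun n => by rw [pow_succ', mul_assoc]
  have hyw : ∀ n : ℕ, y * (v ^ n * x) = v ^ n * x := by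
    rintro (_ | n)
    · rw [pow_zero, one_mul, hyx]
    · rw [ws, ← mul_assoc, hyv]
  have hstep : ∀ m n : ℕ, star (v ^ (m + 1) * x) * (v ^ (n + 1) * x)
      = star (v ^ m * x) * (v ^ n * x) := fun m n => by
    rw [ws, ws, star_mul v, mul_assoc, ← mul_assoc (star v), hv, hyw]
  have hlt : ∀ m k : ℕ, star (v ^ m * x) * (v ^ (m + k + 1) * x) = 0 := by
    intro m k
    induction m with
    | zero => rw [ws, pow_zero, one_mul, ← mul_assoc, hxv, zero_mul]
    | succ m ih => rw [Nat.add_right_comm m 1 k, hstep, ih]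
  refine ⟨hyw, fun n => ?_, fun m n hmn => ?_⟩
  · induction n with
    | zero => rw [pow_zero, one_mul]
    | succ n ih => rw [hstep, ih]
  · rcases lt_or_gt_of_ne hmn with h | h
    · obtain ⟨k, rfl⟩ := Nat.exists_eq_add_of_lt h
      exact hlt m k
    · obtain ⟨k, rfl⟩ := Nat.exists_eq_add_of_lt h
      have := congrArg star (hlt n k)
      rwa [star_mul, star_star, star_zero] at this

variable {M : Type*} [CStarAlgebra M] [PartialOrder M] [StarOrderedRing M]

/-- If the projection `d` is the sum of the initial projections of the `c i`, and the `u i` carry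
the final projections of the `c i` to pairwise orthogonal places, then adding up the `u i * c i`
yields a partial isometry with initial projection `d`, whose range is contained in the join of the
ranges of the `u i`. -/
theorem exists_sum_mul [WStarAlgebra M] {ι : Type*} {u c : ι → M} {d : M}
    (hc : ∀ i, IsStarProjection (star (c i) * c i))
    (hcc : Pairwise fun i j => c i * star (c j) = 0)
    (hu : Pairwise fun i j => star (u i) * u j = 0)
    (huc : ∀ i, star (u i) * u i * c i = c i) (hd : IsOrthSum (fun i => star (c i) * c i) d) :
    ∃ s, star s * s = d ∧ ∀ x, (∀ i, x * u i = 0) → x * s = 0 := by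
  have hi : ∀ i, star (u i * c i) * (u i * c i) = star (c i) * c i := fun i => by
    rw [star_mul, mul_assoc, ← mul_assoc (star (u i)), huc]
  have hi' : ∀ i, IsStarProjection (star (u i * c i) * (u i * c i)) := fun i => by
    rw [hi]; exact hc i
  have h1 : Pairwise fun i j => star (u i * c i) * (u j * c j) = 0 := fun i j hij => by
    simp only
    rw [star_mul, mul_assoc, ← mul_assoc (star (u i)), hu hij, zero_mul, mul_zero]
  have h2 : Pairwise fun i j => u i * c i * star (u j * c j) = 0 := fun i j hij => by
    simp only
    rw [star_mul, mul_assoc, ← mul_assoc (c i), hcc hij, zero_mul, mul_zero]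
  obtain ⟨q, hq⟩ := exists_isOrthSum (fun i => isStarProjection_final (hi' i))
    fun i j hij => final_mul_final (h1 hij)
  obtain ⟨s, hs, hsq⟩ := exists_sum_partialIsometry hi' h1 h2 (by simpa only [hi] using hd) hq
  refine ⟨s, hs, fun x hx => ?_⟩
  have hs' : IsStarProjection (star s * s) := hs.symm ▸ hd.proj
  rw [← final_mul hs', hsq, ← mul_assoc,
    hq.mul_eq_zero x fun i => by rw [← mul_assoc, ← mul_assoc, hx, zero_mul, zero_mul], zero_mul]

/-- Two mutually orthogonal projections are equivalent to `z`. They are not required to lie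
under `z`, which is automatic for central `z`. -/
def HasOrthogonalCopies (z : M) : Prop :=
  ∃ s₁ s₂ : M, star s₁ * s₁ = z ∧ star s₂ * s₂ = z ∧ star s₁ * s₂ = 0

theorem exists_orthogonal_sequence {y : M} (hy : IsInfiniteProj y) :
    ∃ (g : M) (w : ℕ → M), IsStarProjection g ∧ g ≠ 0 ∧ y * g = g ∧
      (∀ n, star (w n) * w n = g) ∧ (∀ n, y * w n = w n) ∧
      Pairwise fun m n => star (w m) * w n = 0 := by
  obtain ⟨hyp, q, hq, hqy, hne, v, hv, hvq⟩ := hy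
  have hyq := (hq.le_iff_mul_eq_right hyp).1 hqy
  have hqv : q * v = v := by
    rw [← hvq, final_mul (hv.symm ▸ hyp)]
  have hyv : y * v = v := by rw [← hqv, ← mul_assoc, hyq]
  have hg : IsStarProjection (y - q) :=
    hq.sub_of_mul_eq_left hyp ((hq.le_iff_mul_eq_left hyp).1 hqy)
  have hyg : y * (y - q) = y - q := by rw [mul_sub, hyp.isIdempotentElem.eq, hyq]
  obtain ⟨h1, h2, h3⟩ := orthogonal_translates hv hyv hyg (by
    rw [hg.isSelfAdjoint.star_eq, sub_mul, hyv, hqv, sub_self])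
  exact ⟨y - q, _, hg, sub_ne_zero.2 hne.symm, hyg, fun n => by
    rw [h2, hg.isSelfAdjoint.star_eq, hg.isIdempotentElem.eq], h1, h3⟩

/-- Twice an infinite set, with two points added, embeds into the set. -/
theorem exists_option_sum_option_injective (A : Type*) [Infinite A] :
    ∃ j : Option A ⊕ Option A → A, Function.Injective j := by
  have h : Cardinal.mk (Option A ⊕ Option A) ≤ Cardinal.mk A := by
    have hA := Cardinal.aleph0_le_mk A
    have h1 : Cardinal.mk A + 1 = Cardinal.mk A :=
      Cardinal.add_one_eq hA
    simp [Cardinal.mk_option, h1, Cardinal.add_eq_self hA]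
  obtain ⟨j⟩ := h
  exact ⟨j, j.injective⟩

/-- An infinite central projection `y` dominates a nonzero central projection `z` with two
orthogonal copies. Take a maximal family of orthogonal copies of some `g ≠ 0` under `y`, infinite by
`exists_orthogonal_sequence`. On a suitable `z`, the remainder of `y` is equivalent to a
subprojection of `g`, so that `z` is cut into one piece more than the family has members, and the
pieces can be moved into the copies of `g` in two disjoint ways. -/
theorem exists_central_hasOrthogonalCopies [WStarAlgebra M] {y : M} (hyc : y ∈ Set.center M)
    (hy : IsInfiniteProj y) :
    ∃ z : M, IsStarProjection z ∧ z ∈ Set.center M ∧ z ≠ 0 ∧ z * y = z ∧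
      HasOrthogonalCopies z := by
  have hyp := hy.1
  obtain ⟨g, w₀, hg, hg0, hyg, hw₀g, hyw₀, hw₀⟩ := exists_orthogonal_sequence hy
  obtain ⟨S, hS₀, hP, hR, hmax⟩ := exists_maximal_pairwise
    (fun u : M => star u * u = g ∧ y * u = u) (fun u v => star u * v = 0)
    (S₀ := Set.range w₀) (by rintro _ ⟨n, rfl⟩; exact ⟨hw₀g n, hyw₀ n⟩)
    (by
      rintro _ ⟨m, rfl⟩ _ ⟨n, rfl⟩ hmn
      exact hw₀ fun h => hmn (congrArg w₀ h))
  have hinj : Function.Injective w₀ := fun m n hmn => by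
    by_contra h
    have := hw₀ h
    simp only [hmn, hw₀g] at this
    exact hg0 this
  have : Infinite S := ((Set.infinite_range_of_injective hinj).mono hS₀).to_subtype
  have hui : ∀ u : S, IsStarProjection (star u.1 * u.1) := fun u => by
    rw [(hP u u.2).1]; exact hg
  have hf : ∀ u : S, IsStarProjection (u.1 * star u.1) := fun u => isStarProjection_final (hui u)
  have horth : Pairwise fun u v : S => star u.1 * v.1 = 0 := fun u v huv =>
    hR u.2 v.2 (Subtype.coe_injective.ne huv)
  obtain ⟨p, hp⟩ := exists_isOrthSum hf fun u v huv => final_mul_final (horth huv)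
  have hyp' : y * p = p := hp.mul_left_eq fun u => by rw [← mul_assoc, (hP u u.2).2]
  have hpy : p * y = p := by rw [← (Set.mem_center_iff.1 hyc).comm, hyp']
  have hr : IsStarProjection (y - p) := hp.proj.sub_of_mul_eq_left hyp hpy
  obtain ⟨w, hwi, hwr, hgw, hsep⟩ := exists_maximal_partialIsometry hr hg
  have hwf := isStarProjection_final hwi
  have hpu : ∀ u ∈ S, p * u = u := fun u hu => by
    have h : u * star u * u = u := final_mul (hui ⟨u, hu⟩)
    rw [← h, ← mul_assoc, hp.mul_eq ⟨u, hu⟩]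
  have hwu : ∀ u ∈ S, w * u = 0 := fun u hu => by
    rw [← hwr, ← hpu u hu, mul_assoc, ← mul_assoc _ p, sub_mul, hyp', hp.proj.isIdempotentElem.eq,
      sub_self, zero_mul, mul_zero]
  have hg' : IsStarProjection (g - w * star w) := hwf.sub_of_mul_eq_right hg (by
    rw [← mul_assoc, hgw])
  obtain ⟨z₀, hz₀, hz₀c, hz₀g, hz₀r⟩ := exists_central_separation hg' hsep
  obtain ⟨z, hz⟩ : ∃ z, z = z₀ * y := ⟨_, rfl⟩
  have hzc : z ∈ Set.center M := hz ▸ Set.mul_mem_center hz₀c hyc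
  have hcomm : ∀ x, z * x = x * z := fun x => (Set.mem_center_iff.1 hzc).comm x
  have hzp : IsStarProjection z := hz ▸ hz₀.mul hyp ((Set.mem_center_iff.1 hz₀c).comm y)
  have hzy : z * y = z := by rw [hz, mul_assoc, hyp.isIdempotentElem.eq]
  -- `w` cannot exhaust `g`, for then `w⋆` would enlarge the maximal family
  have hz0 : z ≠ 0 := by
    intro h
    have hgg : g = w * star w := by
      rw [← sub_eq_zero, ← hz₀g]
      have : y * (g - w * star w) = g - w * star w := by
        rw [mul_sub, hyg, ← hgw, ← mul_assoc, ← mul_assoc, hyg]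
      rw [← this, ← mul_assoc, ← hz, h, zero_mul]
    have hwy : w * y = w := by
      rw [← hwr, mul_assoc, sub_mul, hyp.isIdempotentElem.eq, hpy]
    have hmem := hmax (star w) ⟨by rw [star_star, hgg], by
      rw [← hyp.isSelfAdjoint.star_eq, ← star_mul, hwy]⟩ fun u hu =>
      ⟨by rw [star_star, hwu u hu], by simpa using congrArg star (hwu u hu)⟩
    have := hwu _ hmem
    exact hg0 (hgg.trans this)
  have hzr : z * (y - p) = z * (star w * w) := by
    rw [← sub_eq_zero, ← mul_sub, hz, (Set.mem_center_iff.1 hz₀c).comm y, mul_assoc, hz₀r,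
      mul_zero]
  -- the pieces of `z`: one under `g`, and the members of the family
  let c : Option S → M := fun o => o.elim (w * z) fun u => star u.1 * z
  have hconj : ∀ x : M, star (x * z) * (x * z) = star x * x * z := fun x => by
    rw [star_mul, hzp.isSelfAdjoint.star_eq, mul_assoc, ← mul_assoc (star x), hcomm, mul_assoc,
      hzp.isIdempotentElem.eq]
  have hc : ∀ o, IsStarProjection (star (c o) * c o) := by
    rintro (_ | u)
    · show IsStarProjection (star (w * z) * (w * z))
      rw [hconj]
      exact hwi.mul hzp (hcomm _).symm
    · show IsStarProjection (star (star u.1 * z) * (star u.1 * z))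
      rw [hconj, star_star]
      exact (hf u).mul hzp (hcomm _).symm
  have hcc : Pairwise fun o o' => c o * star (c o') = 0 := by
    have key : ∀ a b : M, a * star b = 0 → a * z * star (b * z) = 0 := fun a b hab => by
      rw [star_mul, hzp.isSelfAdjoint.star_eq, mul_assoc, ← mul_assoc z z,
        hzp.isIdempotentElem.eq, hcomm, ← mul_assoc, hab, zero_mul]
    rintro (_ | u) (_ | v) huv
    · exact (huv rfl).elim
    · exact key _ _ (by rw [star_star, hwu _ v.2])
    · exact key _ _ (by rw [← star_mul, hwu _ u.2, star_zero])
    · exact key _ _ (by rw [star_star]; exact horth fun h => huv (congrArg some h))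
  have hgc : ∀ o, g * c o = c o := by
    rintro (_ | u)
    · show g * (w * z) = w * z
      rw [← mul_assoc, hgw]
    · show g * (star u.1 * z) = star u.1 * z
      have : u.1 * g = u.1 := by rw [← (hP u u.2).1, mul_initial (hui u)]
      rw [← mul_assoc, (mul_eq_self_iff_of_isStarProjection hg).1 this]
  have hd : IsOrthSum (fun o => star (c o) * c o) z := by
    have hnone : star (c none) * c none = star w * w * z := hconj w
    have hsome : ∀ u : S, star (c (some u)) * c (some u) = u.1 * star u.1 * z := fun u => by
      show star (star u.1 * z) * (star u.1 * z) = _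
      rw [hconj, star_star]
    refine ⟨hzp, ?_, fun x hx => ?_⟩
    · rintro (_ | u)
      · rw [hnone, hcomm, mul_assoc, hzp.isIdempotentElem.eq]
      · rw [hsome, hcomm, mul_assoc, hzp.isIdempotentElem.eq]
    · have h1 : x * z * p = 0 := hp.mul_eq_zero _ fun u => by
        rw [mul_assoc, hcomm, ← hsome]; exact hx _
      have h2 : x * z * (y - p) = 0 := by
        rw [mul_assoc, hzr, hcomm, ← hnone]; exact hx _
      conv_lhs => rw [← hzy, ← mul_assoc, ← sub_add_cancel y p, mul_add]
      rw [h1, h2, add_zero]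
  have build : ∀ j : Option S → S, Function.Injective j →
      ∃ s, star s * s = z ∧ ∀ x, (∀ o, x * (j o).1 = 0) → x * s = 0 := fun j hj =>
    exists_sum_mul hc hcc (fun o o' h => horth (hj.ne h))
      (fun o => by rw [(hP _ (j o).2).1, hgc]) hd
  obtain ⟨j, hj⟩ := exists_option_sum_option_injective S
  obtain ⟨s₁, h₁, h₁'⟩ := build (fun o => j (Sum.inl o)) (hj.comp Sum.inl_injective)
  obtain ⟨s₂, h₂, h₂'⟩ := build (fun o => j (Sum.inr o)) (hj.comp Sum.inr_injective)
  refine ⟨z, hzp, hzc, hz0, hzy, s₁, s₂, h₁, h₂, ?_⟩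
  refine h₂' _ fun o => ?_
  have := h₁' (star (j (Sum.inr o)).1) fun o' => horth (hj.ne Sum.inr_ne_inl)
  simpa using congrArg star this

/-- Orthogonal copies of central projections are glued along a maximal orthogonal family, which sums
to `1` because its complement, if nonzero, is infinite. -/
theorem hasOrthogonalCopies_one [WStarAlgebra M] (h : IsProperlyInfinite M) :
    HasOrthogonalCopies (1 : M) := by
  obtain ⟨S, -, hP, hR, hmax⟩ := exists_maximal_pairwise
    (fun z : M => IsStarProjection z ∧ z ∈ Set.center M ∧ z ≠ 0 ∧ HasOrthogonalCopies z)
    (fun z z' => z * z' = 0) (S₀ := ∅) (by simp) (by simp)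
  have horth : Pairwise fun z z' : S => z.1 * z'.1 = 0 := fun u v huv =>
    hR u.2 v.2 (Subtype.coe_injective.ne huv)
  have hproj : ∀ z : S, IsStarProjection z.1 := fun z => (hP z z.2).1
  have hcomm : ∀ (z : S) (x : M), z.1 * x = x * z.1 := fun z x =>
    (Set.mem_center_iff.1 (hP z z.2).2.1).comm x
  obtain ⟨p, hp⟩ := exists_isOrthSum hproj horth
  have hpc : p ∈ Set.center M := mem_center_of_forall_one_sub_mul hp.proj fun x =>
    hp.mul_eq_zero _ fun z => by
      rw [mul_assoc, ← hcomm, ← mul_assoc, sub_mul, hp.mul_eq, one_mul, sub_self, zero_mul]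
  have hpc' : 1 - p ∈ Set.center M := mem_center_of_forall_one_sub_mul hp.proj.one_sub fun x => by
    rw [sub_sub_cancel, (Set.mem_center_iff.1 hpc).comm, mul_assoc, hp.proj.mul_one_sub_self,
      mul_zero]
  have hp1 : p = 1 := by
    by_contra hne
    obtain ⟨z, hz, hzc, hz0, hzp, hcop⟩ := exists_central_hasOrthogonalCopies hpc'
      (h _ hp.proj.one_sub hpc' (sub_ne_zero.2 (Ne.symm hne)))
    have hzu : ∀ u ∈ S, z * u = 0 := fun u hu => by
      rw [← hzp, mul_assoc, sub_mul, hp.mul_eq ⟨u, hu⟩, one_mul, sub_self, mul_zero]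
    have := hmax z ⟨hz, hzc, hz0, hcop⟩ fun u hu =>
      ⟨hzu u hu, by rw [← hzu u hu, (Set.mem_center_iff.1 hzc).comm]⟩
    exact hz0 (hz.isIdempotentElem.eq.symm.trans (hzu z this))
  subst hp1
  choose s₁ s₂ h₁ h₂ h₁₂ using fun z : S => (hP z z.2).2.2.2
  have hs : ∀ (s : S → M), (∀ z, star (s z) * s z = z.1) → ∀ z, z.1 * s z = s z :=
    fun s h z => by
      rw [hcomm]
      conv_lhs => rw [← h z]
      exact mul_initial (by rw [h]; exact hproj z)
  have hcross : ∀ s t : S → M, (∀ z, z.1 * s z = s z) → (∀ z, z.1 * t z = t z) →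
      Pairwise fun z z' => star (s z) * t z' = 0 := fun s t hs ht z z' hzz' => by
    simp only
    rw [← hs z, ← ht z', star_mul, (hproj z).isSelfAdjoint.star_eq, mul_assoc, ← mul_assoc z.1,
      horth hzz', zero_mul, mul_zero]
  have build : ∀ s : S → M, (∀ z, star (s z) * s z = z.1) →
      ∃ t, star t * t = 1 ∧ ∀ x, (∀ z, x * s z = 0) → x * t = 0 := fun s h =>
    exists_sum_mul (c := fun z : S => z.1)
      (fun z => by
        rw [(hproj z).isSelfAdjoint.star_eq, (hproj z).isIdempotentElem.eq]; exact hproj z)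
      (fun z z' hzz' => by
        simp only [(hproj z').isSelfAdjoint.star_eq]; exact horth hzz')
      (hcross s s (hs s h) (hs s h)) (fun z => by rw [h, (hproj z).isIdempotentElem.eq])
      (by simpa only [fun z => (hproj z).isSelfAdjoint.star_eq,
        fun z => (hproj z).isIdempotentElem.eq] using hp)
  obtain ⟨t₁, k₁, k₁'⟩ := build s₁ h₁
  obtain ⟨t₂, k₂, k₂'⟩ := build s₂ h₂
  refine ⟨t₁, t₂, k₁, k₂, k₂' _ fun z => ?_⟩
  have := k₁' (star (s₂ z)) fun z' => by
    by_cases hzz' : z = z'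
    · subst hzz'; simpa using congrArg star (h₁₂ z)
    · exact hcross s₂ s₁ (hs _ h₂) (hs _ h₁) hzz'
  simpa using congrArg star this

end

/-! ### Cuntz families -/

section

theorem unit_eq_one_of_one_mem {M : Type*} [CStarAlgebra M] [PartialOrder M]
    {I : Type*} {e : M} {s : I → M} (h : IsCuntzFamily e s)
    (h1 : (1 : M) ∈ cuntzInverseSemigroup h) : e = 1 := by
  rcases h1 with h0 | ⟨α, β, h1⟩
  · rw [← one_mul e, h0, zero_mul]
  · have : e * 1 = 1 := by
      conv_lhs => rw [h1]
      rw [← mul_assoc, h.unit_mul_word, ← h1]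
    rwa [mul_one] at this

theorem one_mem_cuntzInverseSemigroup {M : Type*} [CStarAlgebra M] [PartialOrder M]
    {I : Type*} {s : I → M} (h : IsCuntzFamily 1 s) :
    (1 : M) ∈ cuntzInverseSemigroup h :=
  Or.inr ⟨[], [], by simp [word]⟩

variable {M : Type*} [CStarAlgebra M] [PartialOrder M] [StarOrderedRing M]

/-- The Schröder–Bernstein argument for `1` and `r`: if `t` is an isometry with range under `r`, and
`f` is the sum of the translates `tⁿ (1 - r) t⋆ⁿ`, then `t f + (1 - f)` is an isometry with range
`r`. -/
theorem exists_isometry_onto [WStarAlgebra M] {t r : M} (ht : star t * t = 1)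
    (hr : IsStarProjection r) (hrt : r * t = t) : ∃ v, star v * v = 1 ∧ v * star v = r := by
  obtain ⟨f₀, hf₀⟩ : ∃ f₀, f₀ = 1 - r := ⟨_, rfl⟩
  have hf₀p : IsStarProjection f₀ := hf₀ ▸ hr.one_sub
  have hf₀t : f₀ * t = 0 := by rw [hf₀, sub_mul, hrt, one_mul, sub_self]
  have htf₀ : star t * f₀ = 0 := by
    have := congrArg star hf₀t
    rwa [star_mul, hf₀p.isSelfAdjoint.star_eq, star_zero] at this
  obtain ⟨-, hn, ho⟩ := orthogonal_translates ht (one_mul t) (one_mul f₀)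
    (by rw [hf₀p.isSelfAdjoint.star_eq, hf₀t])
  have ws : ∀ n : ℕ, t ^ (n + 1) * f₀ = t * (t ^ n * f₀) := fun n => by rw [pow_succ', mul_assoc]
  have hwi : ∀ n : ℕ, IsStarProjection (star (t ^ n * f₀) * (t ^ n * f₀)) := fun n => by
    rw [hn, hf₀p.isSelfAdjoint.star_eq, hf₀p.isIdempotentElem.eq]; exact hf₀p
  obtain ⟨f, hf⟩ := exists_isOrthSum (fun n => isStarProjection_final (hwi n))
    fun m n hmn => final_mul_final (ho hmn)
  have hff := hf.proj.isIdempotentElem.eq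
  have hfs := hf.proj.isSelfAdjoint.star_eq
  have hfw : ∀ n : ℕ, f * (t ^ n * f₀) = t ^ n * f₀ := fun n => by
    rw [← final_mul (hwi n), ← mul_assoc, hf.mul_eq n]
  have hff₀ : f * f₀ = f₀ := by simpa using hfw 0
  have hf₀f : f₀ * f = f₀ := by
    have := congrArg star hff₀
    rwa [star_mul, hf₀p.isSelfAdjoint.star_eq, hfs] at this
  have htf : f * t * f = t * f := by
    have := hf.mul_eq_zero ((1 - f) * t) fun n => by
      rw [← mul_assoc, mul_assoc (1 - f), ← ws, sub_mul, hfw, one_mul, sub_self, zero_mul]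
    rw [sub_mul, sub_mul, one_mul, sub_eq_zero] at this
    exact this.symm
  have hft : f * star t * f = f * star t := by
    have := congrArg star htf
    simpa only [star_mul, hfs, mul_assoc] using this
  -- `t f t⋆` is `f` without its first summand
  have hshift : t * f * star t = f - f₀ := by
    have h1 : (1 - t * f * star t) * (1 - f₀) * f = 0 := hf.mul_eq_zero _ fun n => by
      rw [← mul_assoc]
      refine mul_eq_zero_of_left ?_ _
      rcases n with _ | n
      · rw [pow_zero, one_mul, mul_assoc, hf₀p.one_sub_mul_self, mul_zero]
      · rw [ws, mul_assoc, ← mul_assoc (1 - f₀), sub_mul 1 f₀, hf₀t, one_mul, sub_zero, sub_mul,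
          one_mul, mul_assoc (t * f), ← mul_assoc (star t), ht, one_mul, mul_assoc t, hfw, sub_self]
    rw [mul_assoc, sub_mul 1 f₀, one_mul, hf₀f, sub_mul, one_mul, sub_eq_zero, mul_sub,
      mul_assoc _ _ f₀, htf₀, mul_zero, sub_zero, mul_assoc t, mul_assoc t, hft] at h1
    rw [h1, mul_assoc]
  have e1 : f * star t * t * f = f := by rw [mul_assoc f, ht, mul_one, hff]
  have e2 : f * star t * (1 - f) = 0 := by rw [mul_sub, hft, mul_one, sub_self]
  have e3 : (1 - f) * (t * f) = 0 := by rw [sub_mul, one_mul, ← mul_assoc, htf, sub_self]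
  refine ⟨t * f + (1 - f), ?_, ?_⟩
  · rw [star_add, star_mul, hfs, hf.proj.one_sub.isSelfAdjoint.star_eq, add_mul, mul_add, mul_add,
      ← mul_assoc, e1, e2, e3, hf.proj.one_sub.isIdempotentElem.eq]
    abel
  · have e4 : t * f * (1 - f) = 0 := by rw [mul_assoc, hf.proj.mul_one_sub_self, mul_zero]
    have e5 : (1 - f) * (f * star t) = 0 := by
      rw [← mul_assoc, hf.proj.one_sub_mul_self, zero_mul]
    have e6 : t * f * (f * star t) = f - f₀ := by rw [← mul_assoc, mul_assoc t, hff, hshift]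
    rw [star_add, star_mul, hfs, hf.proj.one_sub.isSelfAdjoint.star_eq, add_mul, mul_add, mul_add,
      e4, e5, e6, hf.proj.one_sub.isIdempotentElem.eq, hf₀]
    abel

/-- The isometries `s₁ⁿ s₂` with `n < N` have orthogonal ranges. Enlarging the range of the one for
`n = 0` to the complement of all the others makes the sum of the ranges equal to `1`. -/
theorem exists_isCuntzFamily [WStarAlgebra M] (h : HasOrthogonalCopies (1 : M)) {N : ℕ∞}
    (hN : 0 < N) : ∃ s : Index N → M, IsCuntzFamily 1 s := by
  classical
  obtain ⟨s₁, s₂, h₁, h₂, h₁₂⟩ := h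
  obtain ⟨-, hn, ho⟩ := orthogonal_translates h₁ (one_mul s₁) (one_mul s₂)
    (by simpa using congrArg star h₁₂)
  obtain ⟨t, ht⟩ : ∃ t : ℕ → M, t = fun n => s₁ ^ n * s₂ := ⟨_, rfl⟩
  have htn : ∀ n, star (t n) * t n = 1 := fun n => by simp only [ht]; rw [hn, h₂]
  have hto : Pairwise fun m n => star (t m) * t n = 0 := by simpa only [ht] using ho
  have htp : ∀ n, IsStarProjection (t n * star (t n)) := fun n =>
    isStarProjection_final (by rw [htn]; exact IsStarProjection.one M)
  have hval : ∀ i j : {i : Index N // i.1 ≠ 0}, i ≠ j → i.1.1 ≠ j.1.1 := fun i j hij h =>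
    hij (Subtype.ext (Subtype.ext h))
  obtain ⟨p, hp⟩ := exists_isOrthSum (e := fun i : {i : Index N // i.1 ≠ 0} =>
    t i.1.1 * star (t i.1.1)) (fun i => htp _) fun i j hij => final_mul_final (hto (hval i j hij))
  have hpt : ∀ i : {i : Index N // i.1 ≠ 0}, p * t i.1.1 = t i.1.1 := fun i => by
    have h := final_mul (u := t i.1.1) (by rw [htn]; exact IsStarProjection.one M)
    rw [← h, ← mul_assoc, hp.mul_eq i]
  obtain ⟨v, hv, hvp⟩ := exists_isometry_onto (htn 0) hp.proj.one_sub (by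
    rw [sub_mul, one_mul, hp.mul_eq_zero' (fun i => htp _) fun i => by
      rw [mul_assoc, hto i.2, mul_zero], sub_zero])
  have hvi : ∀ i : {i : Index N // i.1 ≠ 0}, star v * t i.1.1 = 0 := fun i => by
    have h := final_mul (u := v) (by rw [hv]; exact IsStarProjection.one M)
    rw [← h, hvp, star_mul, hp.proj.one_sub.isSelfAdjoint.star_eq, mul_assoc, sub_mul, hpt, one_mul,
      sub_self, mul_zero]
  let s : Index N → M := fun i => if i.1 = 0 then v else t i.1
  have s0 : ∀ i : Index N, i.1 = 0 → s i = v := fun i hi => if_pos hi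
  have s1 : ∀ i : Index N, i.1 ≠ 0 → s i = t i.1 := fun i hi => if_neg hi
  have hss : ∀ i, star (s i) * s i = 1 := fun i => by
    by_cases hi : i.1 = 0
    · rw [s0 i hi, hv]
    · rw [s1 i hi, htn]
  have hso : ∀ i j, i ≠ j → star (s i) * s j = 0 := fun i j hij => by
    by_cases hi : i.1 = 0 <;> by_cases hj : j.1 = 0
    · exact (hij (Subtype.ext (hi.trans hj.symm))).elim
    · rw [s0 i hi, s1 j hj]; exact hvi ⟨j, hj⟩
    · rw [s1 i hi, s0 j hj]; simpa using congrArg star (hvi ⟨i, hi⟩)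
    · rw [s1 i hi, s1 j hj]; exact hto fun h => hij (Subtype.ext h)
  have hsp : ∀ i, IsStarProjection (s i * star (s i)) := fun i =>
    isStarProjection_final (by rw [hss]; exact IsStarProjection.one M)
  have hsum : IsOrthSum (fun i => s i * star (s i)) 1 := by
    refine ⟨IsStarProjection.one M, fun i => one_mul _, fun y hy => ?_⟩
    have a1 : y * (1 - p) = 0 := by
      have := hy ⟨0, by simpa using hN⟩
      rwa [s0 _ rfl, hvp] at this
    have a2 : y * p = 0 := hp.mul_eq_zero y fun i => by
      have := hy i.1
      rwa [s1 _ i.2] at this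
    rw [mul_sub, a2, sub_zero] at a1
    exact a1
  exact ⟨s, IsStarProjection.one M, hss, fun i => one_mul _, fun i => mul_one _, hso,
    hsum.isLUB hsp fun i j hij => final_mul_final (hso i j hij)⟩

/-- A nonzero central projection `z` is equivalent to `z sᵢ sᵢ⋆`, which misses `z sⱼ sⱼ⋆`. -/
theorem isProperlyInfinite_of_isCuntzFamily {I : Type*} {s : I → M} (h : IsCuntzFamily 1 s)
    {i j : I} (hij : i ≠ j) : IsProperlyInfinite M := by
  intro z hz hzc hz0
  have hcomm : ∀ x, z * x = x * z := fun x => (Set.mem_center_iff.1 hzc).comm x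
  have hzi : star (z * s i) * (z * s i) = z := by
    rw [star_mul, hz.isSelfAdjoint.star_eq, mul_assoc, ← mul_assoc z, hz.isIdempotentElem.eq, hcomm,
      ← mul_assoc, h.star_mul_self, one_mul]
  have hq : IsStarProjection (z * s i * star (z * s i)) := isStarProjection_final (by rwa [hzi])
  refine ⟨hz, _, hq, hq.le_of_mul_eq_right hz ?_, fun heq => hz0 ?_, z * s i, hzi, rfl⟩
  · rw [← mul_assoc, ← mul_assoc, hz.isIdempotentElem.eq]
  · -- `sⱼ⋆ z = sⱼ⋆ (z sᵢ) (z sᵢ)⋆ = 0`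
    have : star (s j) * z = 0 := by
      rw [← heq, hcomm, ← mul_assoc, ← mul_assoc, h.orthogonal j i hij.symm, zero_mul, zero_mul]
    rw [← one_mul z, ← h.star_mul_self j, mul_assoc, ← hcomm, ← mul_assoc, this, zero_mul]

end

end CuntzW

theorem mainTheorem9 {M : Type*} [CStarAlgebra M] [WStarAlgebra M] [PartialOrder M]
    [StarOrderedRing M] :
    (CuntzW.IsProperlyInfinite M ↔
      ∃ N : ℕ∞, 2 ≤ N ∧
        ∃ S : Subsemigroup M, CuntzW.IsCuntzInverseSemigroup N S ∧ (1 : M) ∈ S) ∧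
    (CuntzW.IsProperlyInfinite M →
      ∀ N : ℕ∞, 2 ≤ N →
        ∃ S : Subsemigroup M, CuntzW.IsCuntzInverseSemigroup N S ∧ (1 : M) ∈ S) := by
  have key : CuntzW.IsProperlyInfinite M → ∀ N : ℕ∞, 2 ≤ N →
      ∃ S : Subsemigroup M, CuntzW.IsCuntzInverseSemigroup N S ∧ (1 : M) ∈ S := by
    intro h N hN
    obtain ⟨s, hs⟩ := CuntzW.exists_isCuntzFamily (CuntzW.hasOrthogonalCopies_one h)
      (zero_lt_two.trans_le hN)
    exact ⟨_, ⟨1, s, hs, rfl⟩, CuntzW.one_mem_cuntzInverseSemigroup hs⟩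
  refine ⟨⟨fun h => ⟨2, le_rfl, key h 2 le_rfl⟩, ?_⟩, key⟩
  rintro ⟨N, hN, S, ⟨e, s, hs, rfl⟩, h1⟩
  obtain rfl := CuntzW.unit_eq_one_of_one_mem hs h1
  exact CuntzW.isProperlyInfinite_of_isCuntzFamily hs
    (i := ⟨0, zero_lt_two.trans_le hN⟩) (j := ⟨1, lt_of_lt_of_le (by norm_num) hN⟩) fun h => by
      simpa using congrArg Subtype.val h
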